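/- For a real $2$-homogeneous polynomial $P(x,y)=ax^2+bxy+cy^2$ and finite real exponents $q\ge 1$, $p>2$, put $$|P|_q=\left(|a|^q+|b|^q+|c|^q\right)^{1/q},\qquad \|P\|_p=\sup\{|P(x,y)| : (x,y)\in\mathbb R^2,\ |x|^p+|y|^p\le 1\}.$$ Let $K_{2,q,p}$ denote the optimal constant in the inequality $|P|_q\le K\|P\|_p$, that is, the smallest real $K$ such that this inequality holds for all real $2$-homogeneous polynomials $P$ on $\mathbb R^2$. For every real $q\ge 1$ and every real $p>2$, let $f_{q,p}:[0,1]\to\mathbb R$ be given by $$f_{q,p}(t)=\left[2\left|\frac{2t^p-1}{t^2+(1-t^p)^{2/p}}\right|^q+\left(2t(1-t^p)^{1/p}\,\frac{t^{p-2}+(1-t^p)^{(p-2)/p}}{t^2+(1-t^p)^{2/p}}\right)^q\right]^{1/q}.$$ Then the smallest such constant $K_{2,q,p}$ exists, $f_{q,p}$ attains its maximum on $[0,1]$, and $$K_{2,q,p}=\max\{f_{q,p}(t) : t\in[0,1]\}.$$ -/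

import Mathlib

noncomputable section

namespace PolyNorm

open MvPolynomial

/-- The polynomial norm of `P` viewed as a polynomial on `ℓ_p^n`: the supremum of `|P x|` over the
closed unit ball of `ℝ^n` with the `p`-norm, for a finite real exponent `p ≥ 1`. -/
def polyNorm {n : ℕ} (p : ℝ) (P : MvPolynomial (Fin n) ℝ) : ℝ :=
  sSup {r : ℝ | ∃ x : PiLp (ENNReal.ofReal p) (fun _ : Fin n => ℝ),
    ‖x‖ ≤ 1 ∧ r = |eval (fun i => x i) P|}

/-- The `ℓ_q` norm of the coefficients `a_α`, `|α| = m`, of an `m`-homogeneous polynomial `P`,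
for a finite real exponent `q ≥ 1`. The index set is the finite set of all multi-indices
`α : Fin n →₀ ℕ` with `|α| = m`. -/
def coeffNorm {n : ℕ} (m : ℕ) (q : ℝ) (P : MvPolynomial (Fin n) ℝ) : ℝ :=
  (∑ α ∈ Finset.finsuppAntidiag (Finset.univ : Finset (Fin n)) m, |coeff α P| ^ q) ^ (1 / q)

/-- The constants `K` with `|P|_q ≤ K ‖P‖_p` for all `m`-homogeneous real polynomials `P`
in `n` variables. -/
def admissibleConstants (m n : ℕ) (q p : ℝ) : Set ℝ :=
  {K : ℝ | ∀ P : MvPolynomial (Fin n) ℝ, P.IsHomogeneous m →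
    coeffNorm m q P ≤ K * polyNorm p P}

/-- The optimal constant `K_{m,n,q,p}`. -/
def optimalConstant (m n : ℕ) (q p : ℝ) : ℝ :=
  sInf (admissibleConstants m n q p)

/-- The function `f_{q,p}`, to be considered for `t ∈ [0,1]`. -/
def extremalFun (q p t : ℝ) : ℝ :=
  (2 * |(2 * t ^ p - 1) / (t ^ 2 + (1 - t ^ p) ^ (2 / p))| ^ q
    + (2 * t * (1 - t ^ p) ^ (1 / p)
        * ((t ^ (p - 2) + (1 - t ^ p) ^ ((p - 2) / p))
            / (t ^ 2 + (1 - t ^ p) ^ (2 / p)))) ^ q) ^ (1 / q)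

end PolyNorm

end

/-!
The proof determines, for a point `v = (α, β)` with `α, β ≥ 0` and `α^p + β^p = 1`, all forms
`Q = a x² + b x y + c y²` of norm one on `ℓ_p^2` with `Q(v) = 1`. The Lagrange conditions at `v` are
two linear equations for `(a, b, c)`, so for `α β ≠ 0` these forms lie on a line, parametrized by
`b`. Its point `b = 0` is the diagonal form `D = α^(p-2) x² + β^(p-2) y²`. The inequality
`Q(α, -β) ≤ 1` gives `b ≥ 0`, and `Q(β, -α) ≥ -1` gives `b ≤ B`, where at `b = B` the form is the
extremal one, `E = A (x² - y²) + B x y`. Thus `Q` lies on the segment `[D, E]`, and by convexity of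
`|·|^q` its coefficient sum is at most the larger of those of `D` and `E`. The sum of `D` is at most
`2`, which is the sum of the extremal form `x² - y²` with parameters `(1, 0)`, and the sum of `E` is
`f_{q,p}(α)^q`. If `α β = 0`, then `b = 0` and the sum is again at most `2`. This is
`coeff_sum_le_max_of_eq_one`, and it shows that the supremum of `f_{q,p}` is admissible.

Conversely `E = D - κ (β x - α y)²` with `κ ≥ 0`, and `D ≤ 1` on the unit ball by Young's inequality,
so `E ≤ 1` there. The rotation `(x, y) ↦ (y, -x)` sends `E` to `-E`, whence `‖E‖_p ≤ 1`
(`abs_extremal_form_le_one`), and every admissible constant is at least `f_{q,p}(t)` for each `t`.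
The maximum of `f_{q,p}` exists by continuity on `[0, 1]`.
-/

open MvPolynomial

/-! ### Binary quadratic forms as polynomials -/

theorem finsuppAntidiag_fin_two_two :
    Finset.finsuppAntidiag (Finset.univ : Finset (Fin 2)) 2 =
      {Finsupp.single 0 2, Finsupp.single 0 1 + Finsupp.single 1 1, Finsupp.single 1 2} := by
  ext d
  simp only [Finset.mem_finsuppAntidiag, Fin.sum_univ_two, Finset.mem_insert,
    Finset.mem_singleton, Finset.subset_univ, and_true, Finsupp.ext_iff, Fin.forall_fin_two]
  simp
  lia

theorem single_zero_two_ne :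
    (Finsupp.single 0 2 : Fin 2 →₀ ℕ) ≠ Finsupp.single 0 1 + Finsupp.single 1 1 := by
  simp [Finsupp.ext_iff, Fin.forall_fin_two]

theorem single_zero_two_ne' :
    (Finsupp.single 0 2 : Fin 2 →₀ ℕ) ≠ Finsupp.single 1 2 := by
  simp [Finsupp.ext_iff, Fin.forall_fin_two]

theorem single_zero_one_add_ne :
    (Finsupp.single 0 1 + Finsupp.single 1 1 : Fin 2 →₀ ℕ) ≠ Finsupp.single 1 2 := by
  simp [Finsupp.ext_iff, Fin.forall_fin_two]

theorem sum_finsuppAntidiag_fin_two_two (F : (Fin 2 →₀ ℕ) → ℝ) :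
    ∑ d ∈ Finset.finsuppAntidiag (Finset.univ : Finset (Fin 2)) 2, F d =
      F (Finsupp.single 0 2) + F (Finsupp.single 0 1 + Finsupp.single 1 1)
        + F (Finsupp.single 1 2) := by
  rw [finsuppAntidiag_fin_two_two, Finset.sum_insert, Finset.sum_insert, Finset.sum_singleton,
    add_assoc]
  · simpa using single_zero_one_add_ne
  · simpa using ⟨single_zero_two_ne, single_zero_two_ne'⟩

theorem eval_of_isHomogeneous_two {P : MvPolynomial (Fin 2) ℝ} (hP : P.IsHomogeneous 2)
    (x : Fin 2 → ℝ) :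
    eval x P = coeff (Finsupp.single 0 2) P * x 0 ^ 2
      + coeff (Finsupp.single 0 1 + Finsupp.single 1 1) P * x 0 * x 1
      + coeff (Finsupp.single 1 2) P * x 1 ^ 2 := by
  have hsub : P.support ⊆ Finset.finsuppAntidiag (Finset.univ : Finset (Fin 2)) 2 := by
    intro d hd
    have h := hP (mem_support_iff.mp hd)
    rw [Finset.mem_finsuppAntidiag]
    refine ⟨?_, Finset.subset_univ _⟩
    simpa [Finsupp.weight_apply, Finsupp.sum_fintype] using h
  rw [eval_eq', Finset.sum_subset hsub, sum_finsuppAntidiag_fin_two_two]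
  · simp [Fin.prod_univ_two, mul_assoc]
  · intro d _ hd
    simp [notMem_support_iff.mp hd]

/-- The binary quadratic form `a x² + b x y + c y²` as a polynomial. -/
noncomputable def quadForm (a b c : ℝ) : MvPolynomial (Fin 2) ℝ :=
  monomial (Finsupp.single 0 2) a + monomial (Finsupp.single 0 1 + Finsupp.single 1 1) b
    + monomial (Finsupp.single 1 2) c

theorem quadForm_isHomogeneous (a b c : ℝ) : (quadForm a b c).IsHomogeneous 2 := by
  refine ((isHomogeneous_monomial a ?_).add (isHomogeneous_monomial b ?_)).add
    (isHomogeneous_monomial c ?_) <;> simp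

theorem coeff_quadForm (a b c : ℝ) :
    coeff (Finsupp.single 0 2) (quadForm a b c) = a ∧
      coeff (Finsupp.single 0 1 + Finsupp.single 1 1) (quadForm a b c) = b ∧
      coeff (Finsupp.single 1 2) (quadForm a b c) = c := by
  simp [quadForm, coeff_monomial, single_zero_two_ne, single_zero_two_ne', single_zero_one_add_ne,
    single_zero_two_ne.symm, single_zero_two_ne'.symm, single_zero_one_add_ne.symm]

/-! ### The extremal forms -/

/-- The coefficient `A` in the extremal form `A (x² - y²) + B x y` with parameters `(α, β)`, a point
of the first quadrant of the unit sphere of `ℓ_p^2`. This form takes the value `1` at `(α, β)` and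
`-1` at `(β, -α)`. -/
noncomputable def diagCoeff (p α β : ℝ) : ℝ := (α ^ p - β ^ p) / (α ^ 2 + β ^ 2)

/-- The coefficient `B` in the extremal form `A (x² - y²) + B x y` with parameters `(α, β)`; see
`diagCoeff`. -/
noncomputable def mixedCoeff (p α β : ℝ) : ℝ :=
  2 * α * β * ((α ^ (p - 2) + β ^ (p - 2)) / (α ^ 2 + β ^ 2))

theorem mixedCoeff_nonneg {p α β : ℝ} (hα : 0 ≤ α) (hβ : 0 ≤ β) : 0 ≤ mixedCoeff p α β := by
  unfold mixedCoeff; positivity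

theorem rpow_sub_two_mul_sq {p α : ℝ} (hp : 2 < p) (hα : 0 ≤ α) : α ^ (p - 2) * α ^ 2 = α ^ p := by
  rcases hα.eq_or_lt with rfl | h
  · simp [Real.zero_rpow (show p ≠ 0 by linarith)]
  · rw [← Real.rpow_natCast, ← Real.rpow_add h]; norm_num

theorem rpow_le_one_iff_le_one {x p : ℝ} (hx : 0 ≤ x) (hp : 0 < p) : x ^ p ≤ 1 ↔ x ≤ 1 := by
  simpa using Real.rpow_le_rpow_iff hx zero_le_one hp

theorem sq_add_sq_pos_of_rpow_add_rpow_eq_one {p α β : ℝ} (hp : 2 < p)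
    (h1 : α ^ p + β ^ p = 1) : 0 < α ^ 2 + β ^ 2 := by
  have h0 : p ≠ 0 := by linarith
  by_contra! h
  have hα : α = 0 := by nlinarith [sq_nonneg α, sq_nonneg β]
  have hβ : β = 0 := by nlinarith [sq_nonneg α, sq_nonneg β]
  simp [hα, hβ, h0] at h1

/-- Young's inequality for the conjugate exponents `p / (p - 2)` and `p / 2`. -/
theorem rpow_sub_two_mul_sq_le {p α : ℝ} (hp : 2 < p) (hα : 0 ≤ α) (x : ℝ) :
    α ^ (p - 2) * x ^ 2 ≤ (p - 2) / p * α ^ p + 2 / p * |x| ^ p := by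
  have hp0 : p ≠ 0 := by linarith
  have hx := abs_nonneg x
  have h := Real.geom_mean_le_arith_mean2_weighted (w₁ := (p - 2) / p) (w₂ := 2 / p)
    (div_nonneg (by linarith) (by linarith)) (by positivity)
    (Real.rpow_nonneg hα p) (Real.rpow_nonneg hx p) (by field_simp; ring)
  rw [← Real.rpow_mul hα, ← Real.rpow_mul hx, mul_div_cancel₀ _ hp0, mul_div_cancel₀ _ hp0] at h
  simpa using h

theorem diagonal_form_le_one {p α β x y : ℝ} (hp : 2 < p) (hα : 0 ≤ α) (hβ : 0 ≤ β)
    (h1 : α ^ p + β ^ p = 1) (hxy : |x| ^ p + |y| ^ p ≤ 1) :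
    α ^ (p - 2) * x ^ 2 + β ^ (p - 2) * y ^ 2 ≤ 1 := by
  have hp0 : p ≠ 0 := by linarith
  calc _ ≤ (p - 2) / p * (α ^ p + β ^ p) + 2 / p * (|x| ^ p + |y| ^ p) := by
        linarith [rpow_sub_two_mul_sq_le hp hα x, rpow_sub_two_mul_sq_le hp hβ y]
    _ ≤ (p - 2) / p * 1 + 2 / p * 1 := by rw [h1]; gcongr
    _ = 1 := by field_simp; ring

/-- The extremal form lies below the diagonal form `α^(p-2) x² + β^(p-2) y²`: they differ by a
nonnegative multiple of `(β x - α y)²`. -/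
theorem extremal_form_le_one {p α β x y : ℝ} (hp : 2 < p) (hα : 0 ≤ α) (hβ : 0 ≤ β)
    (h1 : α ^ p + β ^ p = 1) (hxy : |x| ^ p + |y| ^ p ≤ 1) :
    diagCoeff p α β * (x ^ 2 - y ^ 2) + mixedCoeff p α β * x * y ≤ 1 := by
  have hpos := sq_add_sq_pos_of_rpow_add_rpow_eq_one hp h1
  have key : diagCoeff p α β * (x ^ 2 - y ^ 2) + mixedCoeff p α β * x * y =
      α ^ (p - 2) * x ^ 2 + β ^ (p - 2) * y ^ 2
        - (α ^ (p - 2) + β ^ (p - 2)) / (α ^ 2 + β ^ 2) * (β * x - α * y) ^ 2 := by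
    rw [diagCoeff, mixedCoeff, ← rpow_sub_two_mul_sq hp hα, ← rpow_sub_two_mul_sq hp hβ]
    field_simp
    ring
  have : 0 ≤ (α ^ (p - 2) + β ^ (p - 2)) / (α ^ 2 + β ^ 2) * (β * x - α * y) ^ 2 := by positivity
  linarith [diagonal_form_le_one hp hα hβ h1 hxy]

/-- The rotation `(x, y) ↦ (y, -x)` changes the sign of the extremal form, so the upper bound yields
the bound on the absolute value. -/
theorem abs_extremal_form_le_one {p α β x y : ℝ} (hp : 2 < p) (hα : 0 ≤ α) (hβ : 0 ≤ β)
    (h1 : α ^ p + β ^ p = 1) (hxy : |x| ^ p + |y| ^ p ≤ 1) :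
    |diagCoeff p α β * (x ^ 2 - y ^ 2) + mixedCoeff p α β * x * y| ≤ 1 := by
  have h := extremal_form_le_one hp hα hβ h1 (x := y) (y := -x)
    (by rw [abs_neg]; linarith)
  exact abs_le.mpr ⟨by linarith, extremal_form_le_one hp hα hβ h1 hxy⟩

/-! ### Forms of norm one -/

/-- The Lagrange condition in the first coordinate at a point where a form of norm one attains its
maximum: the function `x ↦ ‖(x, β)‖_p² - Q(x, β)` is minimal at `α`. -/
theorem lagrange_fst {p a b c α β : ℝ} (hp : 2 < p) (hα : 0 ≤ α) (hβ : 0 ≤ β)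
    (h1 : α ^ p + β ^ p = 1)
    (hle : ∀ x y : ℝ, a * x ^ 2 + b * x * y + c * y ^ 2 ≤ (|x| ^ p + |y| ^ p) ^ (2 / p))
    (hv : a * α ^ 2 + b * α * β + c * β ^ 2 = 1) :
    2 * a * α + b * β = 2 * (α ^ (p - 2) * α) := by
  have hp0 : p ≠ 0 := by linarith
  have h1' : |α| ^ p + |β| ^ p = 1 := by rwa [abs_of_nonneg hα, abs_of_nonneg hβ]
  have hd : HasDerivAt
      (fun x => (|x| ^ p + |β| ^ p) ^ (2 / p) - (a * x ^ 2 + b * x * β + c * β ^ 2))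
      ((p * |α| ^ (p - 2) * α) * (2 / p) * (|α| ^ p + |β| ^ p) ^ (2 / p - 1)
        - (a * (2 * α) + b * β)) α := by
    have e1 := ((hasDerivAt_abs_rpow α (p := p) (by linarith)).add_const (|β| ^ p)).rpow_const
      (p := 2 / p) (Or.inl (by rw [h1']; exact one_ne_zero))
    have e2 : HasDerivAt (fun x => a * x ^ 2 + b * x * β + c * β ^ 2) (a * (2 * α) + b * β) α := by
      have h2 := ((hasDerivAt_pow 2 α).const_mul a)
      have h3 := (((hasDerivAt_id α).const_mul b).mul_const β)
      exact ((h2.add h3).add_const (c * β ^ 2)).congr_deriv (by simp)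
    exact e1.sub e2
  have hmin : IsLocalMin
      (fun x => (|x| ^ p + |β| ^ p) ^ (2 / p) - (a * x ^ 2 + b * x * β + c * β ^ 2)) α := by
    refine Filter.Eventually.of_forall fun x => ?_
    simp only [h1', hv, Real.one_rpow, sub_self]
    linarith [hle x β]
  have h := hmin.hasDerivAt_eq_zero hd
  rw [h1', Real.one_rpow, abs_of_nonneg hα] at h
  field_simp at h
  linarith

theorem convexOn_abs_rpow {q : ℝ} (hq : 1 ≤ q) : ConvexOn ℝ Set.univ fun x : ℝ => |x| ^ q := by
  refine ⟨convex_univ, fun x _ y _ s t hs ht hst => ?_⟩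
  calc |s • x + t • y| ^ q ≤ (s • |x| + t • |y|) ^ q := by
        refine Real.rpow_le_rpow (abs_nonneg _) ?_ (by linarith)
        refine (abs_add_le _ _).trans_eq ?_
        simp [abs_mul, abs_of_nonneg hs, abs_of_nonneg ht]
    _ ≤ _ := (convexOn_rpow hq).2 (abs_nonneg x) (abs_nonneg y) hs ht hst

/-- For `α, β > 0`, a form of norm one with value `1` at `(α, β)` is a convex combination of the
diagonal form `α^(p-2) x² + β^(p-2) y²`, whose coefficient sum is at most `2`, and the extremal form
with the same parameters. The Lagrange conditions put it on the line through these two forms,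
with parameter `b`; the values at `(α, -β)` and `(β, -α)` confine `b` to the segment between them. -/
theorem coeff_sum_le_max_of_eq_one {p q a b c α β : ℝ} (hq : 1 ≤ q) (hp : 2 < p)
    (hα : 0 ≤ α) (hβ : 0 ≤ β) (h1 : α ^ p + β ^ p = 1)
    (hle : ∀ x y : ℝ, |a * x ^ 2 + b * x * y + c * y ^ 2| ≤ (|x| ^ p + |y| ^ p) ^ (2 / p))
    (hv : a * α ^ 2 + b * α * β + c * β ^ 2 = 1) :
    |a| ^ q + |b| ^ q + |c| ^ q ≤
      max 2 (2 * |diagCoeff p α β| ^ q + |mixedCoeff p α β| ^ q) := by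
  have hq0 : 0 ≤ q := by linarith
  have hp0 : p ≠ 0 := by linarith
  have one_le {x : ℝ} (hx : |x| ≤ 1) : |x| ^ q ≤ 1 := Real.rpow_le_one (abs_nonneg x) hx hq0
  have ha1 : |a| ≤ 1 := by simpa [hp0] using hle 1 0
  have hc1 : |c| ≤ 1 := by simpa [hp0] using hle 0 1
  have hx := lagrange_fst hp hα hβ h1 (fun x y => (le_abs_self _).trans (hle x y)) hv
  have hy := lagrange_fst hp hβ hα (by linarith) (a := c) (b := b) (c := a)
    (fun x y => by
      have := (le_abs_self _).trans (hle y x)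
      rw [add_comm (|x| ^ p)]; linarith) (by linarith)
  -- When one of the coordinates vanishes, the Lagrange conditions force `b = 0`.
  have degenerate (hb : b = 0) : |a| ^ q + |b| ^ q + |c| ^ q ≤
      max 2 (2 * |diagCoeff p α β| ^ q + |mixedCoeff p α β| ^ q) := by
    refine le_max_of_le_left ?_
    rw [hb, abs_zero, Real.zero_rpow (by linarith)]
    linarith [one_le ha1, one_le hc1]
  rcases hα.eq_or_lt with rfl | hα'
  · have : β ≠ 0 := by rintro rfl; simp [hp0] at h1
    exact degenerate (by simpa [this] using hx)
  rcases hβ.eq_or_lt with rfl | hβ'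
  · exact degenerate (by simpa [hα'.ne'] using hy)
  have hαp := rpow_sub_two_mul_sq hp hα
  have hβp := rpow_sub_two_mul_sq hp hβ
  set A := α ^ (p - 2) with hA
  set B := β ^ (p - 2) with hB
  have hA0 : 0 < A := by positivity
  have hB0 : 0 < B := by positivity
  have hs : 0 < α ^ 2 + β ^ 2 := by positivity
  have ea : a = A - b * β / (2 * α) := by field_simp; linarith
  have ec : c = B - b * α / (2 * β) := by field_simp; linarith
  -- Compare the values at `(α, β)` and `(α, -β)`.
  have hb0 : 0 ≤ b := by
    have h := (abs_le.mp (hle α (-β))).2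
    rw [abs_neg, abs_of_nonneg hα, abs_of_nonneg hβ, h1, Real.one_rpow] at h
    have : 0 ≤ b * (α * β) := by linarith
    exact nonneg_of_mul_nonneg_left this (by positivity)
  -- The value at `(β, -α)` is at least `-1 = -(α ^ p + β ^ p)`.
  have hbm : b ≤ mixedCoeff p α β := by
    have h := (abs_le.mp (hle β (-α))).1
    rw [abs_neg, abs_of_nonneg hα, abs_of_nonneg hβ, add_comm, h1, Real.one_rpow] at h
    have h2 : b * (α ^ 2 + β ^ 2) ^ 2 ≤ 2 * α * β * (A + B) * (α ^ 2 + β ^ 2) := by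
      have e : a * β ^ 2 + b * β * -α + c * (-α) ^ 2 + (A * α ^ 2 + B * β ^ 2) =
          (A + B) * (α ^ 2 + β ^ 2) - b * (α ^ 2 + β ^ 2) ^ 2 / (2 * α * β) := by
        rw [ea, ec]; field_simp; ring
      have e' : b * (α ^ 2 + β ^ 2) ^ 2 / (2 * α * β) ≤ (A + B) * (α ^ 2 + β ^ 2) := by
        rw [hαp, hβp, h1] at e; linarith
      rw [div_le_iff₀ (by positivity)] at e'
      linarith
    rw [mixedCoeff, ← hA, ← hB, ← mul_div_assoc, le_div_iff₀ hs]
    refine le_of_mul_le_mul_right ?_ hs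
    linarith
  -- The form is a convex combination of the diagonal form and the extremal one.
  have hm0 : 0 < mixedCoeff p α β := by unfold mixedCoeff; positivity
  set m := mixedCoeff p α β with hm
  have em : m * (α ^ 2 + β ^ 2) = 2 * α * β * (A + B) := by
    rw [hm, mixedCoeff, ← hA, ← hB]; field_simp
  have ed1 : diagCoeff p α β = A - m * β / (2 * α) := by
    rw [diagCoeff, ← hαp, ← hβp, div_eq_iff hs.ne']; field_simp
    linear_combination β * em
  have ed2 : -diagCoeff p α β = B - m * α / (2 * β) := by
    rw [diagCoeff, ← hαp, ← hβp, ← neg_div, div_eq_iff hs.ne']; field_simp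
    linear_combination α * em
  set d := diagCoeff p α β
  set θ := b / m with hθ
  have hθ0 : 0 ≤ θ := by positivity
  have hθ1 : θ ≤ 1 := (div_le_one hm0).2 hbm
  have eb : b = θ * m := by rw [hθ]; field_simp
  have conv (u v : ℝ) : |(1 - θ) * u + θ * v| ^ q ≤ (1 - θ) * |u| ^ q + θ * |v| ^ q :=
    (convexOn_abs_rpow hq).2 (Set.mem_univ u) (Set.mem_univ v) (by linarith) hθ0 (by ring)
  have ca := conv A d
  have cb := conv 0 m
  have cc := conv B (-d)
  rw [show (1 - θ) * A + θ * d = a by rw [ea, eb, ed1]; ring] at ca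
  rw [show (1 - θ) * 0 + θ * m = b by rw [eb]; ring, abs_zero, Real.zero_rpow (by linarith)] at cb
  rw [show (1 - θ) * B + θ * -d = c by rw [ec, eb, ed2]; ring, abs_neg] at cc
  have hα1 : α ≤ 1 := 
    (rpow_le_one_iff_le_one (p := p) hα (by linarith)).1 (by linarith [Real.rpow_nonneg hβ p])
  have hβ1 : β ≤ 1 := 
    (rpow_le_one_iff_le_one (p := p) hβ (by linarith)).1 (by linarith [Real.rpow_nonneg hα p])
  have hAq : |A| ^ q ≤ 1 :=
    one_le (by rw [abs_of_pos hA0]; exact Real.rpow_le_one hα hα1 (by linarith))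
  have hBq : |B| ^ q ≤ 1 :=
    one_le (by rw [abs_of_pos hB0]; exact Real.rpow_le_one hβ hβ1 (by linarith))
  calc |a| ^ q + |b| ^ q + |c| ^ q
      ≤ (1 - θ) * (|A| ^ q + |B| ^ q) + θ * (2 * |d| ^ q + |m| ^ q) := by linarith
    _ ≤ (1 - θ) * max 2 (2 * |d| ^ q + |m| ^ q) + θ * max 2 (2 * |d| ^ q + |m| ^ q) := by
        have : 0 ≤ 1 - θ := by linarith
        gcongr
        · exact le_max_of_le_left (by linarith)
        · exact le_max_right _ _
    _ = _ := by ring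

/-- The signs of the form and of the point where the norm is attained are normalized by replacing
`Q` with `-Q` and `y` with `-y`; neither changes the absolute values of the coefficients. -/
theorem coeff_sum_le_of_norm_one {p q M a b c x y : ℝ} (hq : 1 ≤ q) (hp : 2 < p)
    (hM : ∀ α β : ℝ, 0 ≤ α → 0 ≤ β → α ^ p + β ^ p = 1 →
      2 * |diagCoeff p α β| ^ q + |mixedCoeff p α β| ^ q ≤ M)
    (hle : ∀ x y : ℝ, |a * x ^ 2 + b * x * y + c * y ^ 2| ≤ (|x| ^ p + |y| ^ p) ^ (2 / p))
    (hxy : |x| ^ p + |y| ^ p = 1) (hv : |a * x ^ 2 + b * x * y + c * y ^ 2| = 1) :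
    |a| ^ q + |b| ^ q + |c| ^ q ≤ M := by
  have hp0 : p ≠ 0 := by linarith
  have hq0 : q ≠ 0 := by linarith
  -- The parameters `(1, 0)` give the form `x² - y²`.
  have h2 : 2 ≤ M := by
    simpa [diagCoeff, mixedCoeff, hp0, hq0] using hM 1 0 zero_le_one le_rfl (by simp [hp0])
  have main {a b c : ℝ}
      (hle : ∀ x y : ℝ, |a * x ^ 2 + b * x * y + c * y ^ 2| ≤ (|x| ^ p + |y| ^ p) ^ (2 / p))
      (hv : a * |x| ^ 2 + b * |x| * |y| + c * |y| ^ 2 = 1) : |a| ^ q + |b| ^ q + |c| ^ q ≤ M :=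
    (coeff_sum_le_max_of_eq_one hq hp (abs_nonneg x) (abs_nonneg y) hxy hle hv).trans
      (max_le h2 (hM _ _ (abs_nonneg x) (abs_nonneg y) hxy))
  have hneg {a b c : ℝ}
      (hle : ∀ x y : ℝ, |a * x ^ 2 + b * x * y + c * y ^ 2| ≤ (|x| ^ p + |y| ^ p) ^ (2 / p)) :
      ∀ x y : ℝ, |-a * x ^ 2 + -b * x * y + -c * y ^ 2| ≤ (|x| ^ p + |y| ^ p) ^ (2 / p) := by
    intro x y
    rw [← abs_neg]
    convert hle x y using 2
    ring
  have hflip : ∀ x y : ℝ, |a * x ^ 2 + -b * x * y + c * y ^ 2| ≤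
      (|x| ^ p + |y| ^ p) ^ (2 / p) := by
    intro x y
    have h := hle x (-y)
    rw [abs_neg] at h
    convert h using 2
    ring
  have hsgn : |x| * |y| = x * y ∨ |x| * |y| = -(x * y) := by
    rw [← abs_mul]; exact abs_choice _
  rcases hsgn with hs | hs <;> rcases (abs_eq zero_le_one).1 hv with h | h
  · exact main hle (by rw [sq_abs, sq_abs, mul_assoc, hs]; linarith)
  · simpa using main (hneg hle) (by rw [sq_abs, sq_abs, mul_assoc, hs]; linarith)
  · simpa using main hflip (by rw [sq_abs, sq_abs, mul_assoc, hs]; linarith)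
  · simpa using main (hneg hflip) (by rw [sq_abs, sq_abs, mul_assoc, hs]; linarith)

/-! ### The polynomial norm -/

theorem norm_le_one_iff {p : ℝ} (hp : 0 < p)
    (x : PiLp (ENNReal.ofReal p) (fun _ : Fin 2 => ℝ)) :
    ‖x‖ ≤ 1 ↔ |x 0| ^ p + |x 1| ^ p ≤ 1 := by
  have hr : (ENNReal.ofReal p).toReal = p := ENNReal.toReal_ofReal hp.le
  rw [PiLp.norm_eq_sum (by rwa [hr]), hr, Fin.sum_univ_two, Real.norm_eq_abs, Real.norm_eq_abs,
    one_div,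
    Real.rpow_inv_le_iff_of_pos (by positivity) zero_le_one hp, Real.one_rpow]

/-- The supremum defining `polyNorm` is attained, since the unit ball is compact; in particular it
is not a junk value. -/
theorem polyNorm_fin_two {p : ℝ} (hp : 0 < p) {P : MvPolynomial (Fin 2) ℝ} {a b c : ℝ}
    (hP : ∀ x, eval x P = a * x 0 ^ 2 + b * x 0 * x 1 + c * x 1 ^ 2) :
    IsGreatest ((fun z : ℝ × ℝ => |a * z.1 ^ 2 + b * z.1 * z.2 + c * z.2 ^ 2|) ''
      {z | |z.1| ^ p + |z.2| ^ p ≤ 1}) (PolyNorm.polyNorm p P) := by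
  have hset : {r : ℝ | ∃ x : PiLp (ENNReal.ofReal p) (fun _ : Fin 2 => ℝ),
      ‖x‖ ≤ 1 ∧ r = |eval (fun i => x i) P|} =
      (fun z : ℝ × ℝ => |a * z.1 ^ 2 + b * z.1 * z.2 + c * z.2 ^ 2|) ''
        {z | |z.1| ^ p + |z.2| ^ p ≤ 1} := by
    ext r
    constructor
    · rintro ⟨x, hx, rfl⟩
      exact ⟨(x 0, x 1), (norm_le_one_iff hp x).1 hx, by rw [hP]⟩
    · rintro ⟨z, hz, rfl⟩
      refine ⟨WithLp.toLp _ ![z.1, z.2], (norm_le_one_iff hp _).2 (by simpa using hz), ?_⟩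
      rw [hP]; simp
  rw [PolyNorm.polyNorm, hset]
  refine IsCompact.isGreatest_sSup (IsCompact.image ?_ (by fun_prop)) ⟨_, (0, 0), ?_, rfl⟩
  · have hcont : Continuous fun z : ℝ × ℝ => |z.1| ^ p + |z.2| ^ p :=
      (continuous_fst.abs.rpow_const fun _ => Or.inr hp.le).add
        (continuous_snd.abs.rpow_const fun _ => Or.inr hp.le)
    refine (isCompact_Icc (a := ((-1, -1) : ℝ × ℝ)) (b := (1, 1))).of_isClosed_subset
      (isClosed_le hcont continuous_const) ?_
    rintro ⟨x, y⟩ hz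
    have hz : |x| ^ p + |y| ^ p ≤ 1 := hz
    have hx := abs_nonneg x
    have hy := abs_nonneg y
    have hx1 := (rpow_le_one_iff_le_one hx hp).1
      (by linarith [Real.rpow_nonneg hy p])
    have hy1 := (rpow_le_one_iff_le_one hy hp).1
      (by linarith [Real.rpow_nonneg hx p])
    exact ⟨⟨(abs_le.1 hx1).1, (abs_le.1 hy1).1⟩, ⟨(abs_le.1 hx1).2, (abs_le.1 hy1).2⟩⟩
  · simp [hp.ne']

/-- A bound on the unit ball extends to the whole plane by homogeneity. -/
theorem abs_quadForm_le_of_ball {p N a b c : ℝ} (hp : 0 < p)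
    (hle : ∀ x y : ℝ, |x| ^ p + |y| ^ p ≤ 1 → |a * x ^ 2 + b * x * y + c * y ^ 2| ≤ N) (x y : ℝ) :
    |a * x ^ 2 + b * x * y + c * y ^ 2| ≤ N * (|x| ^ p + |y| ^ p) ^ (2 / p) := by
  have hx := Real.rpow_nonneg (abs_nonneg x) p
  have hy := Real.rpow_nonneg (abs_nonneg y) p
  rcases (add_nonneg hx hy).eq_or_lt with h | h
  · have hx0 : x = 0 := by
      have : |x| ^ p = 0 := by linarith
      simpa using (Real.rpow_eq_zero (abs_nonneg x) hp.ne').1 this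
    have hy0 : y = 0 := by
      have : |y| ^ p = 0 := by linarith
      simpa using (Real.rpow_eq_zero (abs_nonneg y) hp.ne').1 this
    have : (0 : ℝ) ^ (2 / p) = 0 := Real.zero_rpow (by positivity)
    simp [hx0, hy0, hp.ne', this]
  · set s := (|x| ^ p + |y| ^ p) ^ (1 / p) with hs
    have hs0 : 0 < s := by positivity
    have hsp : s ^ p = |x| ^ p + |y| ^ p := by
      rw [hs, ← Real.rpow_mul h.le, one_div_mul_cancel hp.ne', Real.rpow_one]
    have hs2 : (|x| ^ p + |y| ^ p) ^ (2 / p) = s ^ 2 := by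
      rw [hs, ← Real.rpow_natCast, ← Real.rpow_mul h.le]; congr 1; push_cast; ring
    have hb := hle (x / s) (y / s) (by
      rw [abs_div, abs_div, abs_of_pos hs0, Real.div_rpow (abs_nonneg x) hs0.le,
        Real.div_rpow (abs_nonneg y) hs0.le, hsp, ← add_div, div_self h.ne'])
    have e : a * (x / s) ^ 2 + b * (x / s) * (y / s) + c * (y / s) ^ 2 =
        (a * x ^ 2 + b * x * y + c * y ^ 2) / s ^ 2 := by field_simp
    rw [e, abs_div, abs_of_pos (pow_pos hs0 2), div_le_iff₀ (by positivity)] at hb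
    rwa [hs2]

/-- The bound `coeff_sum_le_of_norm_one` applied to a form divided by its norm. -/
theorem coeff_sum_le_of_isGreatest {p q M N a b c : ℝ} (hq : 1 ≤ q) (hp : 2 < p)
    (hM : ∀ α β : ℝ, 0 ≤ α → 0 ≤ β → α ^ p + β ^ p = 1 →
      2 * |diagCoeff p α β| ^ q + |mixedCoeff p α β| ^ q ≤ M)
    (hN : IsGreatest ((fun z : ℝ × ℝ => |a * z.1 ^ 2 + b * z.1 * z.2 + c * z.2 ^ 2|) ''
      {z | |z.1| ^ p + |z.2| ^ p ≤ 1}) N) :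
    |a| ^ q + |b| ^ q + |c| ^ q ≤ M * N ^ q := by
  have hp0 : 0 < p := by linarith
  have hq0 : q ≠ 0 := by linarith
  obtain ⟨⟨⟨x, y⟩, hxy, hv⟩, hmax⟩ := hN
  have hxy : |x| ^ p + |y| ^ p ≤ 1 := hxy
  have hv : |a * x ^ 2 + b * x * y + c * y ^ 2| = N := hv
  have hle := abs_quadForm_le_of_ball hp0 (a := a) (b := b) (c := c) (N := N)
    fun x y h => hmax ⟨(x, y), h, rfl⟩
  have hN0 : 0 ≤ N := hv ▸ abs_nonneg _
  rcases hN0.eq_or_lt with rfl | hN0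
  · have ha : a = 0 := by simpa [hp0.ne'] using hle 1 0
    have hc : c = 0 := by simpa [hp0.ne'] using hle 0 1
    have hb : b = 0 := by simpa [ha, hc] using hle 1 1
    simp [ha, hb, hc, hq0]
  · have e (x y : ℝ) : a / N * x ^ 2 + b / N * x * y + c / N * y ^ 2 =
        (a * x ^ 2 + b * x * y + c * y ^ 2) / N := by field_simp
    have hle' (x y : ℝ) : |a / N * x ^ 2 + b / N * x * y + c / N * y ^ 2| ≤
        (|x| ^ p + |y| ^ p) ^ (2 / p) := by
      rw [e, abs_div, abs_of_pos hN0, div_le_iff₀ hN0]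
      linarith [hle x y]
    have hv' : |a / N * x ^ 2 + b / N * x * y + c / N * y ^ 2| = 1 := by
      rw [e, abs_div, abs_of_pos hN0, hv, div_self hN0.ne']
    -- A maximum point lies on the unit sphere, by homogeneity.
    have hxy1 : |x| ^ p + |y| ^ p = 1 := by
      refine le_antisymm hxy ?_
      by_contra! h
      have h2 := hle' x y
      rw [hv'] at h2
      linarith [Real.rpow_lt_one (by positivity) h (by positivity : 0 < 2 / p)]
    have h := coeff_sum_le_of_norm_one hq hp hM hle' hxy1 hv'
    have hNq : 0 < N ^ q := Real.rpow_pos_of_pos hN0 q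
    simp only [abs_div, abs_of_pos hN0, Real.div_rpow (abs_nonneg _) hN0.le] at h
    rwa [← add_div, ← add_div, div_le_iff₀ hNq] at h

/-! ### The function `f_{q,p}` and admissible constants -/

/-- The value `f_{q,p}(t)` is the coefficient norm of the extremal form with parameters
`(t, (1 - t^p)^(1/p))`. -/
theorem extremalFun_eq {p q t : ℝ} (hp : 2 < p) (ht : t ∈ Set.Icc (0 : ℝ) 1) :
    PolyNorm.extremalFun q p t =
      (2 * |diagCoeff p t ((1 - t ^ p) ^ (1 / p))| ^ q
        + |mixedCoeff p t ((1 - t ^ p) ^ (1 / p))| ^ q) ^ (1 / q) := by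
  have hu : 0 ≤ 1 - t ^ p := sub_nonneg.2 (Real.rpow_le_one ht.1 ht.2 (by linarith))
  have hp0 : p ≠ 0 := by linarith
  have hr (r : ℝ) : (1 - t ^ p) ^ (r / p) = ((1 - t ^ p) ^ (1 / p)) ^ r := by
    rw [← Real.rpow_mul hu]; congr 1; ring
  have hpow : ((1 - t ^ p) ^ (1 / p)) ^ p = 1 - t ^ p := by
    rw [← hr, div_self hp0, Real.rpow_one]
  rw [abs_of_nonneg (mixedCoeff_nonneg ht.1 (Real.rpow_nonneg hu _)), diagCoeff, mixedCoeff, hpow,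
    PolyNorm.extremalFun, hr 2, hr (p - 2), Real.rpow_two]
  congr 6
  ring

theorem continuousOn_extremalFun {p q : ℝ} (hq : 1 ≤ q) (hp : 2 < p) :
    ContinuousOn (PolyNorm.extremalFun q p) (Set.Icc 0 1) := by
  have hpow (r : ℝ) (hr : 0 ≤ r) : Continuous fun t : ℝ => t ^ r :=
    Real.continuous_rpow_const hr
  have h1 := hpow p (by linarith)
  have h2 := hpow (p - 2) (by linarith)
  have h3 (r : ℝ) (hr : 0 ≤ r) : Continuous fun t : ℝ => (1 - t ^ p) ^ (r / p) :=
    (continuous_const.sub h1).rpow_const fun _ => Or.inr (div_nonneg hr (by linarith))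
  have h4 := h3 2 zero_le_two
  have h5 := h3 1 zero_le_one
  have h6 := h3 (p - 2) (by linarith)
  have hden : ∀ t ∈ Set.Icc (0 : ℝ) 1, t ^ 2 + (1 - t ^ p) ^ (2 / p) ≠ 0 := by
    intro t ht
    rcases ht.1.eq_or_lt with rfl | h
    · simp [Real.zero_rpow (show p ≠ 0 by linarith)]
    · have hu : 0 ≤ 1 - t ^ p := sub_nonneg.2 (Real.rpow_le_one ht.1 ht.2 (by linarith))
      positivity
  have hdenc : ContinuousOn (fun t : ℝ => t ^ 2 + (1 - t ^ p) ^ (2 / p)) (Set.Icc 0 1) :=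
    ((continuous_pow 2).add h4).continuousOn
  unfold PolyNorm.extremalFun
  refine ContinuousOn.rpow_const (ContinuousOn.add (continuousOn_const.mul
    (ContinuousOn.rpow_const (ContinuousOn.abs (ContinuousOn.div ?_ hdenc hden)) ?_))
    (ContinuousOn.rpow_const (ContinuousOn.mul ?_ (ContinuousOn.div ?_ hdenc hden)) ?_)) ?_
  · exact ((continuous_const.mul h1).sub continuous_const).continuousOn
  · exact fun _ _ => Or.inr (by linarith)
  · exact ((continuous_const.mul continuous_id).mul h5).continuousOn
  · exact (h2.add h6).continuousOn
  · exact fun _ _ => Or.inr (by linarith)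
  · exact fun _ _ => Or.inr (by positivity)

theorem coeffNorm_fin_two (q : ℝ) (P : MvPolynomial (Fin 2) ℝ) :
    PolyNorm.coeffNorm 2 q P = (|coeff (Finsupp.single 0 2) P| ^ q
      + |coeff (Finsupp.single 0 1 + Finsupp.single 1 1) P| ^ q
      + |coeff (Finsupp.single 1 2) P| ^ q) ^ (1 / q) := by
  rw [PolyNorm.coeffNorm, sum_finsuppAntidiag_fin_two_two fun d => |coeff d P| ^ q]

theorem extremalFun_nonneg {p q t : ℝ} (hp : 2 < p) (ht : t ∈ Set.Icc (0 : ℝ) 1) :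
    0 ≤ PolyNorm.extremalFun q p t := by
  rw [extremalFun_eq hp ht]; positivity

theorem mem_admissibleConstants_of_forall_le {p q K : ℝ} (hq : 1 ≤ q) (hp : 2 < p)
    (hK : ∀ t ∈ Set.Icc (0 : ℝ) 1, PolyNorm.extremalFun q p t ≤ K) :
    K ∈ PolyNorm.admissibleConstants 2 2 q p := by
  intro P hP
  have hp0 : 0 < p := by linarith
  have hq0 : 0 < q := by linarith
  have h0 : (0 : ℝ) ∈ Set.Icc (0 : ℝ) 1 := by simp
  have hK0 : 0 ≤ K := (extremalFun_nonneg hp h0).trans (hK 0 h0)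
  have hN := polyNorm_fin_two hp0 (eval_of_isHomogeneous_two hP)
  have hN0 : 0 ≤ PolyNorm.polyNorm p P := by
    obtain ⟨⟨z, -, hz⟩, -⟩ := hN
    exact hz ▸ abs_nonneg _
  have hM : ∀ α β : ℝ, 0 ≤ α → 0 ≤ β → α ^ p + β ^ p = 1 →
      2 * |diagCoeff p α β| ^ q + |mixedCoeff p α β| ^ q ≤ K ^ q := by
    intro α β hα hβ h
    have hα1 : α ≤ 1 := (rpow_le_one_iff_le_one hα hp0).1
      (by linarith [Real.rpow_nonneg hβ p])
    have hβe : (1 - α ^ p) ^ (1 / p) = β := by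
      rw [show 1 - α ^ p = β ^ p by linarith, ← Real.rpow_mul hβ, mul_one_div_cancel hp0.ne',
        Real.rpow_one]
    have hf := hK α ⟨hα, hα1⟩
    rw [extremalFun_eq hp ⟨hα, hα1⟩, hβe] at hf
    rwa [one_div, Real.rpow_inv_le_iff_of_pos (by positivity) hK0 hq0] at hf
  have h := coeff_sum_le_of_isGreatest hq hp hM hN
  rw [coeffNorm_fin_two, one_div, Real.rpow_inv_le_iff_of_pos (by positivity) (by positivity) hq0,
    Real.mul_rpow hK0 hN0]
  exact h

/-- Tested on the form `x²`. -/
theorem nonneg_of_mem_admissibleConstants {p q K : ℝ} (hp : 0 < p)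
    (hK : K ∈ PolyNorm.admissibleConstants 2 2 q p) : 0 ≤ K := by
  have hP := quadForm_isHomogeneous 1 0 0
  have h := hK _ hP
  obtain ⟨e1, e2, e3⟩ := coeff_quadForm 1 0 0
  obtain ⟨⟨z, -, hz⟩, -⟩ := polyNorm_fin_two hp (eval_of_isHomogeneous_two hP)
  have hN0 : 0 ≤ PolyNorm.polyNorm p (quadForm 1 0 0) := hz ▸ abs_nonneg _
  rw [coeffNorm_fin_two, e1, e2, e3, abs_one, Real.one_rpow] at h
  have hpos : 0 < K * PolyNorm.polyNorm p (quadForm 1 0 0) := lt_of_lt_of_le (by positivity) h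
  exact (pos_of_mul_pos_left hpos hN0).le

theorem extremalFun_le_of_mem_admissibleConstants {p q K t : ℝ} (hp : 2 < p)
    (hK : K ∈ PolyNorm.admissibleConstants 2 2 q p) (ht : t ∈ Set.Icc (0 : ℝ) 1) :
    PolyNorm.extremalFun q p t ≤ K := by
  have hp0 : 0 < p := by linarith
  have hu : 0 ≤ 1 - t ^ p := sub_nonneg.2 (Real.rpow_le_one ht.1 ht.2 hp0.le)
  rw [extremalFun_eq hp ht]
  set β := (1 - t ^ p) ^ (1 / p) with hβdef
  have hβ : 0 ≤ β := Real.rpow_nonneg hu _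
  have h1 : t ^ p + β ^ p = 1 := by
    rw [hβdef, ← Real.rpow_mul hu, one_div_mul_cancel hp0.ne', Real.rpow_one]; ring
  set P := quadForm (diagCoeff p t β) (mixedCoeff p t β) (-diagCoeff p t β) with hPdef
  have hP : P.IsHomogeneous 2 := quadForm_isHomogeneous _ _ _
  obtain ⟨e1, e2, e3⟩ := coeff_quadForm (diagCoeff p t β) (mixedCoeff p t β) (-diagCoeff p t β)
  have hN := polyNorm_fin_two hp0 (eval_of_isHomogeneous_two hP)
  rw [← hPdef] at e1 e2 e3
  have hle := hK P hP
  rw [e1, e2, e3] at hN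
  rw [coeffNorm_fin_two, e1, e2, e3, abs_neg,
    show ∀ u v : ℝ, u + v + u = 2 * u + v from fun u v => by ring] at hle
  obtain ⟨⟨z, hz, hzN⟩, hmax⟩ := hN
  have hN1 : PolyNorm.polyNorm p P ≤ 1 := by
    rw [← hzN]
    convert abs_extremal_form_le_one hp ht.1 hβ h1 hz using 2
    ring
  exact hle.trans (mul_le_of_le_one_right (nonneg_of_mem_admissibleConstants hp0 hK) hN1)

/-- For finite `q ≥ 1` and `p > 2`, the optimal constant `K_{2,2,q,p}` is attained (it is the least
admissible constant) and it is the maximum of `f_{q,p}` over `[0,1]`. -/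
theorem theorem3p3 (q p : ℝ) (hq : 1 ≤ q) (hp : 2 < p) :
    IsLeast (PolyNorm.admissibleConstants 2 2 q p) (PolyNorm.optimalConstant 2 2 q p) ∧
      IsGreatest (PolyNorm.extremalFun q p '' Set.Icc (0 : ℝ) 1)
        (PolyNorm.optimalConstant 2 2 q p) := by
  obtain ⟨t, ht, hmax⟩ := isCompact_Icc.exists_isMaxOn (Set.nonempty_Icc.2 zero_le_one)
    (continuousOn_extremalFun hq hp)
  have hleast : IsLeast (PolyNorm.admissibleConstants 2 2 q p) (PolyNorm.extremalFun q p t) :=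
    ⟨mem_admissibleConstants_of_forall_le hq hp hmax,
      fun _ hK => extremalFun_le_of_mem_admissibleConstants hp hK ht⟩
  have hopt : PolyNorm.optimalConstant 2 2 q p = PolyNorm.extremalFun q p t := hleast.csInf_eq
  rw [hopt]
  exact ⟨hleast, ⟨t, ht, rfl⟩, by rintro _ ⟨s, hs, rfl⟩; exact hmax hs⟩
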